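/- Let $a_n>0$ and $b_n\in\mathbb R$ ($n=0,1,2,\dots$), and let $(\mathcal J u)_0=b_0u_0+a_0u_1$, $(\mathcal J u)_n=a_{n-1}u_{n-1}+b_nu_n+a_nu_{n+1}$ for $n\ge 1$, be the action of the corresponding Jacobi matrix on complex sequences $u=(u_n)_{n\ge0}$. Let $\mathcal D(J_{\max})$ be the set of all $u\in\ell^2$ with $\mathcal J u\in\ell^2$, and $\langle u,v\rangle=\sum_{n\ge 0} u_n\overline{v_n}$. Put $$\beta_n=-\frac{b_n}{2\sqrt{a_{n-1}a_n}}\quad(n\ge 1),\qquad \alpha_n=\sqrt{a_{n+1}/a_n},\qquad k_n=\frac{\alpha_{n-1}}{\alpha_n}\quad(n\ge1),$$ and let $\beta_0\in\mathbb R$ be any fixed number. Assume that $$\sum_{n\ge0}a_n^{-1}<\infty,\qquad \beta_n\to\beta_\infty\ \text{ with }|\beta_\infty|<1,\qquad \sum_{n\ge 1}|k_n-1|<\infty,\qquad \sum_{n\ge 0}|\beta_{n+1}-\beta_n|<\infty .$$ Set $\varphi_n=\sum\arccos\beta_m$, the sum over $0\le m\le n-1$ with $|\beta_m|\le 1$.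 For $z\in\mathbb C$ let $p(z)=(p_n(z))$ and $q(z)=(q_n(z))$ be the solutions of $$a_{n-1}u_{n-1}+b_nu_n+a_nu_{n+1}=zu_n,\qquad n\ge1,\tag{1}$$ with $p_0=1$, $p_1=(z-b_0)/a_0$ and $q_0=0$, $q_1=1/a_0$. Then: **(a)** For all $z\in\mathbb C$ the sequences $p(z),q(z)$ belong to $\ell^2$; equation (1) has unique solutions $f^{(+)}(z)$ and $f^{(-)}(z)$ (the Jost solutions) with $f^{(\pm)}_n(z)=a_n^{-1/2}e^{\pm i\varphi_n}(1+o(1))$ as $n\to\infty$; and there are unique numbers $\sigma_\pm(z),\tau_\pm(z)\in\mathbb C$ such that for all $n\ge0$ $$p_n(z)=\sigma_+(z)f^{(+)}_n(z)+\sigma_-(z)f^{(-)}_n(z),\qquad q_n(z)=\tau_+(z)f^{(+)}_n(z)+\tau_-(z)f^{(-)}_n(z).$$ For $h\in\ell^2$ put $$(\mathcal R(z)h)_n=q_n(z)\sum_{m=0}^np_m(z)h_m+p_n(z)\sum_{m=n+1}^\infty q_m(z)h_m .$$ **(b)** For every $u\in\mathcal D(J_{\max})$ there are numbers $s_\pm=s_\pm(u)\in\mathbb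 C$ such that $$u_n=a_n^{-1/2}\bigl(s_+e^{i\varphi_n}+s_-e^{-i\varphi_n}+o(1)\bigr),\qquad n\to\infty,\tag{2}$$ and for every $z\in\mathbb C$ they are given by $$s_\pm=\Gamma\,\sigma_\pm(z)+\langle(\mathcal J-z)u,\,p(\bar z)\rangle\,\tau_\pm(z),$$ where $\Gamma\in\mathbb C$ is the unique number with $u=\Gamma\,p(z)+\mathcal R(z)(\mathcal J-z)u$. **(c)** Conversely, for arbitrary $s_+,s_-\in\mathbb C$ there exists $u\in\mathcal D(J_{\max})$ such that (2) holds. -/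

import Mathlib

open Filter Topology

namespace JacobiLC

/-- The action of the Jacobi matrix with off-diagonal entries `a` and diagonal entries `b` on a
column `u`. -/
noncomputable def jacobi (a b : ℕ → ℝ) (u : ℕ → ℂ) : ℕ → ℂ
  | 0 => (b 0 : ℂ) * u 0 + (a 0 : ℂ) * u 1
  | n + 1 => (a n : ℂ) * u n + (b (n + 1) : ℂ) * u (n + 1) + (a (n + 1) : ℂ) * u (n + 2)

/-- The sequence `(𝓙 - z) u`. -/
noncomputable def jacobiSub (a b : ℕ → ℝ) (z : ℂ) (u : ℕ → ℂ) : ℕ → ℂ :=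
  fun n => jacobi a b u n - z * u n

/-- The domain of the maximal Jacobi operator: `u ∈ ℓ²` with `𝓙 u ∈ ℓ²`. -/
def maxDomain (a b : ℕ → ℝ) : Set (ℕ → ℂ) :=
  {u | Memℓp u 2 ∧ Memℓp (jacobi a b u) 2}

/-- The difference equation `a_{n-1} u_{n-1} + b_n u_n + a_n u_{n+1} = z u_n` for `n ≥ 1`. -/
def IsSolution (a b : ℕ → ℝ) (z : ℂ) (u : ℕ → ℂ) : Prop :=
  ∀ n : ℕ, 1 ≤ n →
    (a (n - 1) : ℂ) * u (n - 1) + (b n : ℂ) * u n + (a n : ℂ) * u (n + 1) = z * u n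

/-- The orthogonal polynomials of the first kind: the solution with
`p_0 = 1`, `p_1 = (z - b_0) / a_0`. -/
noncomputable def polyP (a b : ℕ → ℝ) (z : ℂ) : ℕ → ℂ
  | 0 => 1
  | 1 => (z - (b 0 : ℂ)) / (a 0 : ℂ)
  | n + 2 => ((z - (b (n + 1) : ℂ)) * polyP a b z (n + 1) - (a n : ℂ) * polyP a b z n)
      / (a (n + 1) : ℂ)

/-- The orthogonal polynomials of the second kind: the solution with
`q_0 = 0`, `q_1 = 1 / a_0`. -/
noncomputable def polyQ (a b : ℕ → ℝ) (z : ℂ) : ℕ → ℂ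
  | 0 => 0
  | 1 => 1 / (a 0 : ℂ)
  | n + 2 => ((z - (b (n + 1) : ℂ)) * polyQ a b z (n + 1) - (a n : ℂ) * polyQ a b z n)
      / (a (n + 1) : ℂ)

/-- The scalar product `⟨u, v⟩ = ∑ u_n conj(v_n)` of `ℓ²`, linear in the first argument. -/
noncomputable def l2Inner (u v : ℕ → ℂ) : ℂ :=
  ∑' n : ℕ, u n * (starRingEnd ℂ) (v n)

/-- The quasiresolvent
`(R(z) h)_n = q_n(z) ∑_{m ≤ n} p_m(z) h_m + p_n(z) ∑_{m > n} q_m(z) h_m`. -/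
noncomputable def quasiResolvent (a b : ℕ → ℝ) (z : ℂ) (h : ℕ → ℂ) (n : ℕ) : ℂ :=
  polyQ a b z n * ∑ m ∈ Finset.range (n + 1), polyP a b z m * h m
    + polyP a b z n * ∑' m : ℕ, polyQ a b z (n + 1 + m) * h (n + 1 + m)

/-- The ratios `β_n = -b_n / (2 √(a_{n-1} a_n))`, `n ≥ 1`. For `n = 0` this formula would involve
the undefined number `a_{-1}`, so the value `β_0` is a free parameter. -/
noncomputable def beta (a b : ℕ → ℝ) (β₀ : ℝ) : ℕ → ℝ
  | 0 => β₀
  | n + 1 => -b (n + 1) / (2 * √(a n * a (n + 1)))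

/-- `alpha a n = √(a_{n+1} / a_n)`. -/
noncomputable def alpha (a : ℕ → ℝ) (n : ℕ) : ℝ := √(a (n + 1) / a n)

/-- `kRatio a n = α_{n-1} / α_n`, used for `n ≥ 1` only. -/
noncomputable def kRatio (a : ℕ → ℝ) (n : ℕ) : ℝ := alpha a (n - 1) / alpha a n

open Classical in
/-- The phases `φ_n = ∑ arccos β_m`, the sum over `0 ≤ m ≤ n - 1` with `|β_m| ≤ 1`. -/
noncomputable def phase (a b : ℕ → ℝ) (β₀ : ℝ) (n : ℕ) : ℝ :=
  ∑ m ∈ (Finset.range n).filter (fun m => |beta a b β₀ m| ≤ 1), Real.arccos (beta a b β₀ m)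

/-- For `s = 1` and `s = -1`: `f` is a solution of the difference equation such that
`f_n = a_n^{-1/2} e^{i s φ_n} (1 + o(1))` as `n → ∞`. -/
def IsJostSolution (a b : ℕ → ℝ) (β₀ : ℝ) (s : ℝ) (z : ℂ) (f : ℕ → ℂ) : Prop :=
  IsSolution a b z f ∧
    ∃ r : ℕ → ℂ, Tendsto r atTop (𝓝 0) ∧
      ∀ n : ℕ, f n = ((√(a n) : ℝ) : ℂ)⁻¹ *
        Complex.exp (Complex.I * (s : ℂ) * (phase a b β₀ n : ℂ)) * (1 + r n)

/-- `u_n = a_n^{-1/2} (s₊ e^{i φ_n} + s₋ e^{-i φ_n} + o(1))` as `n → ∞`. -/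
def HasAsymptotics (a b : ℕ → ℝ) (β₀ : ℝ) (u : ℕ → ℂ) (sp sm : ℂ) : Prop :=
  ∃ r : ℕ → ℂ, Tendsto r atTop (𝓝 0) ∧
    ∀ n : ℕ, u n = ((√(a n) : ℝ) : ℂ)⁻¹ *
      (sp * Complex.exp (Complex.I * (phase a b β₀ n : ℂ))
        + sm * Complex.exp (-(Complex.I * (phase a b β₀ n : ℂ))) + r n)

end JacobiLC

namespace JacobiLC

/-! Put `v_n = √a_n u_n`. Dividing row `n + 1` of the Jacobi equation by `√a_n` turns it into
`v_{n+2} = 2β_{n+1} v_{n+1} - v_n` up to errors governed by `|k_{n+1} - 1|`, `|z| / √(a_n a_{n+1})`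
and `((𝓙 - z)u)_{n+1} / √a_n`. All are summable, the last by Cauchy–Schwarz for every `u` in the
maximal domain. As `|β_∞| < 1`, the characteristic roots `w_n^{±1}`, `w_n = e^{i arccos β_n}`, are
eventually unimodular, separated and of bounded variation, so the coordinates of `v` along them
converge by Gronwall. Thus `exists_hasAsymptotics` treats `p`, `q` and the whole maximal domain at
once.

Uniqueness comes from the constant Wronskian: a solution with zero asymptotics has zero Wronskian
with `p` and `q`, hence vanishes (`IsSolution.eq_zero`). So the coefficient matrix of `p`, `q` is
invertible, and its inverse yields the Jost solutions without a separate construction.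

For (b), `u - R(z)(𝓙 - z)u` satisfies every row, including row 0, so it is a multiple of `p(z)`,
while `R(z)h` behaves like `⟨h, p(z̄)⟩ q(z)`; the coefficients are then compared. For (c), a
combination of the Jost solutions at `z = 0` suffices. -/

/-! ### Perturbed recurrences of bounded variation -/

/-- A discrete Gronwall argument: a sequence whose increments are controlled by a summable multiple
of its size plus a summable error is a Cauchy sequence. -/
theorem cauchySeq_of_norm_sub_le_mul_add {E : Type*} [SeminormedAddCommGroup E] {X : ℕ → E}
    {c d : ℕ → ℝ} (hc0 : ∀ n, 0 ≤ c n) (hd0 : ∀ n, 0 ≤ d n) (hc : Summable c) (hd : Summable d)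
    (h : ∀ n, ‖X (n + 1) - X n‖ ≤ c n * ‖X n‖ + d n) : CauchySeq X := by
  have key : ∀ n, ‖X n‖ ≤ (‖X 0‖ + ∑ k ∈ Finset.range n, d k)
      * Real.exp (∑ k ∈ Finset.range n, c k) := by
    intro n
    induction n with
    | zero => simp
    | succ n ih =>
      rw [Finset.sum_range_succ, Finset.sum_range_succ, Real.exp_add]
      set S := ∑ k ∈ Finset.range n, d k
      set e := Real.exp (∑ k ∈ Finset.range n, c k)
      have hS : 0 ≤ S := Finset.sum_nonneg fun k _ => hd0 k
      have he : 1 ≤ e := Real.one_le_exp (Finset.sum_nonneg fun k _ => hc0 k)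
      have h1 : c n + 1 ≤ Real.exp (c n) := Real.add_one_le_exp _
      have h2 : 1 ≤ Real.exp (c n) := Real.one_le_exp (hc0 n)
      have h3 : ‖X (n + 1)‖ ≤ (c n + 1) * ‖X n‖ + d n := by
        have := norm_add_le (X (n + 1) - X n) (X n)
        rw [sub_add_cancel] at this
        linarith [h n]
      have h4 : (c n + 1) * ‖X n‖ ≤ Real.exp (c n) * ((‖X 0‖ + S) * e) :=
        mul_le_mul h1 ih (norm_nonneg _) (Real.exp_pos _).le
      have h5 : d n * 1 ≤ d n * (e * Real.exp (c n)) :=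
        mul_le_mul_of_nonneg_left (one_le_mul_of_one_le_of_one_le he h2) (hd0 n)
      calc ‖X (n + 1)‖ ≤ Real.exp (c n) * ((‖X 0‖ + S) * e) + d n * (e * Real.exp (c n)) := by
            linarith
        _ = _ := by ring
  set B := (‖X 0‖ + ∑' k, d k) * Real.exp (∑' k, c k)
  have hB : ∀ n, ‖X n‖ ≤ B := fun n => (key n).trans <| by
    have h1 : ∑ k ∈ Finset.range n, d k ≤ ∑' k, d k := hd.sum_le_tsum _ fun k _ => hd0 k
    have h2 : ∑ k ∈ Finset.range n, c k ≤ ∑' k, c k := hc.sum_le_tsum _ fun k _ => hc0 k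
    have h3 : 0 ≤ ∑ k ∈ Finset.range n, d k := Finset.sum_nonneg fun k _ => hd0 k
    exact mul_le_mul (by linarith) (Real.exp_le_exp.2 h2) (Real.exp_pos _).le
      (by have := norm_nonneg (X 0); linarith)
  refine cauchySeq_of_summable_dist (Summable.of_nonneg_of_le (fun _ => dist_nonneg) (fun n => ?_)
    ((hc.mul_right B).add hd))
  rw [dist_comm, dist_eq_norm]
  have := mul_le_mul_of_nonneg_left (hB n) (hc0 n)
  linarith [h n]

/-- The increment of the coordinate `(v_{n+1} - w_n⁻¹ v_n) / e_{n+1}` along a perturbation of the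
recurrence `v_{n+2} = (w_{n+1} + w_{n+1}⁻¹) v_{n+1} - v_n`. -/
theorem norm_coordinate_sub_le {w w' e e' v₀ v₁ v₂ : ℂ} (hw : ‖w‖ = 1) (hw' : ‖w'‖ = 1)
    (he : ‖e‖ = 1) (hee : e' = w' * e) :
    ‖(v₂ - w'⁻¹ * v₁) / e' - (v₁ - w⁻¹ * v₀) / e‖
      ≤ ‖w' - w‖ * ‖v₀‖ + ‖v₂ - (w' + w'⁻¹) * v₁ + v₀‖ := by
  have hw0 : w ≠ 0 := by rintro rfl; simp at hw
  have hw0' : w' ≠ 0 := by rintro rfl; simp at hw'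
  have he0 : e ≠ 0 := by rintro rfl; simp at he
  -- The coordinate is exactly conserved when `w' = w` and the recurrence is unperturbed; each
  -- summand measures one of these two defects.
  have : (v₂ - w'⁻¹ * v₁) / e' - (v₁ - w⁻¹ * v₀) / e
      = (w' - w) * v₀ / (w * w' * e) + (v₂ - (w' + w'⁻¹) * v₁ + v₀) / (w' * e) := by
    subst hee
    field_simp
    ring
  rw [this]
  refine (norm_add_le _ _).trans (le_of_eq ?_)
  simp [hw, hw', he]

/-- Solutions of a summable perturbation of `v_{n+2} = (w_{n+1} + w_{n+1}⁻¹) v_{n+1} - v_n`, where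
the unimodular numbers `w_n` have bounded variation and stay away from `±1`. -/
theorem exists_tendsto_of_perturbed_recurrence {w e v : ℕ → ℂ} {c d : ℕ → ℝ} {δ : ℝ} {winf : ℂ}
    (hδ : 0 < δ) (hw : ∀ n, ‖w n‖ = 1) (he : ∀ n, ‖e n‖ = 1) (hew : ∀ n, e (n + 1) = w n * e n)
    (hwδ : ∀ n, δ ≤ ‖w n - (w n)⁻¹‖) (hwlim : Tendsto w atTop (𝓝 winf))
    (hvar : Summable fun n => ‖w (n + 1) - w n‖)
    (hc0 : ∀ n, 0 ≤ c n) (hd0 : ∀ n, 0 ≤ d n) (hc : Summable c) (hd : Summable d)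
    (hv : ∀ n, ‖v (n + 2) - (w (n + 1) + (w (n + 1))⁻¹) * v (n + 1) + v n‖
      ≤ c n * (‖v n‖ + ‖v (n + 1)‖) + d n) :
    ∃ s t : ℂ, Tendsto (fun n => v n - (s * e n + t * (e n)⁻¹)) atTop (𝓝 0) := by
  have hw0 : ∀ n, w n ≠ 0 := fun n h => by simpa [h] using hw n
  have he0 : ∀ n, e n ≠ 0 := fun n h => by simpa [h] using he n
  have hwd0 : ∀ n, w n - (w n)⁻¹ ≠ 0 := fun n h => by
    have := hwδ n
    rw [h, norm_zero] at this
    linarith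
  -- Each of `X`, `Y` annihilates one characteristic root and has the oscillation of the other
  -- divided out. Since `w n - (w n)⁻¹` is bounded below, `v` is recovered from them.
  set X : ℕ → ℂ := fun n => (v (n + 1) - (w n)⁻¹ * v n) / e (n + 1) with hX
  set Y : ℕ → ℂ := fun n => (v (n + 1) - w n * v n) / (e (n + 1))⁻¹ with hY
  have hv0 : ∀ n, v n = (X n * e (n + 1) - Y n * (e (n + 1))⁻¹) / (w n - (w n)⁻¹) := by
    intro n
    have := he0 (n + 1)
    have := hw0 n
    rw [eq_div_iff (hwd0 n)]
    simp only [hX, hY]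
    field_simp
    ring
  have hv1 : ∀ n, v (n + 1)
      = (w n * (X n * e (n + 1)) - (w n)⁻¹ * (Y n * (e (n + 1))⁻¹)) / (w n - (w n)⁻¹) := by
    intro n
    have := he0 (n + 1)
    have := hw0 n
    rw [eq_div_iff (hwd0 n)]
    simp only [hX, hY]
    field_simp
    ring
  set Z : ℕ → ℂ × ℂ := fun n => (X n, Y n) with hZ
  have hdiv : ∀ n (x : ℂ) (A : ℝ), ‖x‖ ≤ A → ‖x / (w n - (w n)⁻¹)‖ ≤ A / δ := by
    intro n x A hx
    rw [norm_div]
    exact div_le_div₀ ((norm_nonneg _).trans hx) hx hδ (hwδ n)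
  have hb0 : ∀ n, ‖v n‖ ≤ 2 * ‖Z n‖ / δ := by
    intro n
    rw [hv0 n]
    refine hdiv n _ _ ((norm_sub_le _ _).trans ?_)
    have h1 : ‖X n‖ ≤ ‖Z n‖ := norm_fst_le (Z n)
    have h2 : ‖Y n‖ ≤ ‖Z n‖ := norm_snd_le (Z n)
    simp only [norm_mul, norm_inv, he, inv_one, mul_one]
    linarith
  have hb1 : ∀ n, ‖v (n + 1)‖ ≤ 2 * ‖Z n‖ / δ := by
    intro n
    rw [hv1 n]
    refine hdiv n _ _ ((norm_sub_le _ _).trans ?_)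
    have h1 : ‖X n‖ ≤ ‖Z n‖ := norm_fst_le (Z n)
    have h2 : ‖Y n‖ ≤ ‖Z n‖ := norm_snd_le (Z n)
    simp only [norm_mul, norm_inv, he, hw, inv_one, mul_one, one_mul]
    linarith
  have hincr : ∀ n, ‖Z (n + 1) - Z n‖
      ≤ ((‖w (n + 1) - w n‖ + 2 * c n) * (2 / δ)) * ‖Z n‖ + d n := by
    intro n
    have hbase : ‖w (n + 1) - w n‖ * ‖v n‖
          + ‖v (n + 2) - (w (n + 1) + (w (n + 1))⁻¹) * v (n + 1) + v n‖
        ≤ ((‖w (n + 1) - w n‖ + 2 * c n) * (2 / δ)) * ‖Z n‖ + d n := by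
      have h1 := mul_le_mul_of_nonneg_left (hb0 n) (norm_nonneg (w (n + 1) - w n))
      have h2 := mul_le_mul_of_nonneg_left (add_le_add (hb0 n) (hb1 n)) (hc0 n)
      calc _ ≤ ‖w (n + 1) - w n‖ * (2 * ‖Z n‖ / δ)
            + (c n * (2 * ‖Z n‖ / δ + 2 * ‖Z n‖ / δ) + d n) := by linarith [hv n]
        _ = _ := by ring
    refine max_le ?_ ?_
    · exact (norm_coordinate_sub_le (hw n) (hw (n + 1)) (he (n + 1)) (hew (n + 1))).trans hbase
    -- The second coordinate is the first one for the inverse data; inversion preserves distances on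
    -- the unit circle.
    · have h := norm_coordinate_sub_le (w := (w n)⁻¹) (w' := (w (n + 1))⁻¹) (e := (e (n + 1))⁻¹)
        (e' := (e (n + 2))⁻¹) (v₀ := v n) (v₁ := v (n + 1)) (v₂ := v (n + 2))
        (by simp [hw]) (by simp [hw]) (by simp [he]) (by rw [hew (n + 1), mul_inv])
      have hinv : ‖(w (n + 1))⁻¹ - (w n)⁻¹‖ = ‖w (n + 1) - w n‖ := by
        rw [inv_sub_inv (hw0 _) (hw0 _), norm_div, norm_mul, hw, hw, norm_sub_rev]
        simp
      rw [inv_inv, inv_inv, hinv, add_comm (w (n + 1))⁻¹] at h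
      exact h.trans hbase
  obtain ⟨⟨x, y⟩, hlim⟩ := cauchySeq_tendsto_of_complete (cauchySeq_of_norm_sub_le_mul_add
    (fun n => by have := hc0 n; positivity) hd0 ((hvar.add (hc.mul_left 2)).mul_right (2 / δ)) hd
    hincr)
  have hXlim : Tendsto X atTop (𝓝 x) := (continuous_fst.tendsto _).comp hlim
  have hYlim : Tendsto Y atTop (𝓝 y) := (continuous_snd.tendsto _).comp hlim
  have hwinf : ‖winf‖ = 1 :=
    tendsto_nhds_unique hwlim.norm (by simp [hw])
  have hwinf0 : winf ≠ 0 := by rintro rfl; simp at hwinf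
  have hwilim : Tendsto (fun n => (w n)⁻¹) atTop (𝓝 winf⁻¹) := hwlim.inv₀ hwinf0
  have hdinf : winf - winf⁻¹ ≠ 0 := fun h => by
    have := ge_of_tendsto (hwlim.sub hwilim).norm (Eventually.of_forall hwδ)
    rw [h, norm_zero] at this
    linarith
  have hS : Tendsto (fun n => X n * w n / (w n - (w n)⁻¹)) atTop
      (𝓝 (x * winf / (winf - winf⁻¹))) := (hXlim.mul hwlim).div (hwlim.sub hwilim) hdinf
  have hT : Tendsto (fun n => -(Y n * (w n)⁻¹) / (w n - (w n)⁻¹)) atTop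
      (𝓝 (-(y * winf⁻¹) / (winf - winf⁻¹))) := (hYlim.mul hwilim).neg.div (hwlim.sub hwilim) hdinf
  refine ⟨x * winf / (winf - winf⁻¹), -(y * winf⁻¹) / (winf - winf⁻¹), ?_⟩
  rw [tendsto_zero_iff_norm_tendsto_zero]
  have h0 := ((tendsto_sub_nhds_zero_iff.2 hS).norm).add ((tendsto_sub_nhds_zero_iff.2 hT).norm)
  rw [norm_zero, add_zero] at h0
  refine squeeze_zero (fun _ => norm_nonneg _) (fun n => ?_) h0
  have heq : v n - (x * winf / (winf - winf⁻¹) * e n + -(y * winf⁻¹) / (winf - winf⁻¹) * (e n)⁻¹)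
      = (X n * w n / (w n - (w n)⁻¹) - x * winf / (winf - winf⁻¹)) * e n
        + (-(Y n * (w n)⁻¹) / (w n - (w n)⁻¹) - -(y * winf⁻¹) / (winf - winf⁻¹)) * (e n)⁻¹ := by
    rw [hv0 n, hew n, mul_inv]
    ring
  rw [heq]
  refine (norm_add_le _ _).trans (le_of_eq ?_)
  simp only [norm_mul, norm_inv, he, inv_one, mul_one]

/-! ### Calculus of the asymptotic relations -/

theorem norm_exp_I_mul_phase (a b : ℕ → ℝ) (β₀ : ℝ) (n : ℕ) :
    ‖Complex.exp (Complex.I * (phase a b β₀ n : ℂ))‖ = 1 := by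
  rw [mul_comm]; exact Complex.norm_exp_ofReal_mul_I _

theorem hasAsymptotics_iff {a b : ℕ → ℝ} (ha : ∀ n, 0 < a n) {β₀ : ℝ} {u : ℕ → ℂ} {s t : ℂ} :
    HasAsymptotics a b β₀ u s t ↔
      Tendsto (fun n => ((√(a n) : ℝ) : ℂ) * u n
        - (s * Complex.exp (Complex.I * (phase a b β₀ n : ℂ))
          + t * (Complex.exp (Complex.I * (phase a b β₀ n : ℂ)))⁻¹)) atTop (𝓝 0) := by
  have hr : ∀ n, ((√(a n) : ℝ) : ℂ) ≠ 0 := fun n =>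
    Complex.ofReal_ne_zero.2 (Real.sqrt_pos.2 (ha n)).ne'
  constructor
  · rintro ⟨r, hr0, hu⟩
    refine hr0.congr fun n => ?_
    rw [hu n, mul_inv_cancel_left₀ (hr n), Complex.exp_neg]
    ring
  · refine fun h => ⟨_, h, fun n => ?_⟩
    rw [Complex.exp_neg, add_sub_cancel, inv_mul_cancel_left₀ (hr n)]

theorem HasAsymptotics.linear_combination {a b : ℕ → ℝ} (ha : ∀ n, 0 < a n) {β₀ : ℝ}
    {u v : ℕ → ℂ} {s t s' t' : ℂ} (hu : HasAsymptotics a b β₀ u s t)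
    (hv : HasAsymptotics a b β₀ v s' t') (x y : ℂ) :
    HasAsymptotics a b β₀ (fun n => x * u n + y * v n) (x * s + y * s') (x * t + y * t') := by
  rw [hasAsymptotics_iff ha] at *
  have := (hu.const_mul x).add (hv.const_mul y)
  rw [mul_zero, mul_zero, add_zero] at this
  refine this.congr fun n => ?_
  ring

theorem HasAsymptotics.norm_le {a b : ℕ → ℝ} (ha : ∀ n, 0 < a n) {β₀ : ℝ} {u : ℕ → ℂ} {s t : ℂ}
    (hu : HasAsymptotics a b β₀ u s t) : ∃ C, ∀ n, ‖((√(a n) : ℝ) : ℂ) * u n‖ ≤ C := by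
  obtain ⟨C, hC⟩ := ((hasAsymptotics_iff ha).1 hu).norm.bddAbove_range
  refine ⟨C + (‖s‖ + ‖t‖), fun n => ?_⟩
  have h1 := hC ⟨n, rfl⟩
  simp only at h1
  set E := Complex.exp (Complex.I * (phase a b β₀ n : ℂ)) with hE
  have hE1 : ‖E‖ = 1 := norm_exp_I_mul_phase a b β₀ n
  have h2 : ‖s * E + t * E⁻¹‖ ≤ ‖s‖ + ‖t‖ := by
    refine (norm_add_le _ _).trans (le_of_eq ?_)
    simp [hE1]
  have h3 := norm_add_le (((√(a n) : ℝ) : ℂ) * u n - (s * E + t * E⁻¹)) (s * E + t * E⁻¹)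
  rw [sub_add_cancel] at h3
  linarith

/-- The exponential is unimodular, so the relative error of the Jost condition and the additive
error of `HasAsymptotics` are interchangeable. -/
theorem isJostSolution_one_iff {a b : ℕ → ℝ} {β₀ : ℝ} {z : ℂ}
    {f : ℕ → ℂ} : IsJostSolution a b β₀ 1 z f ↔
      IsSolution a b z f ∧ HasAsymptotics a b β₀ f 1 0 := by
  refine and_congr_right fun _ => ⟨?_, ?_⟩
  · rintro ⟨r, hr, hf⟩
    refine ⟨fun n => Complex.exp (Complex.I * (phase a b β₀ n : ℂ)) * r n, ?_, fun n => ?_⟩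
    · rw [tendsto_zero_iff_norm_tendsto_zero] at hr ⊢
      simpa [norm_exp_I_mul_phase] using hr
    · rw [hf n, Complex.ofReal_one, mul_one]; ring
  · rintro ⟨r, hr, hf⟩
    refine ⟨fun n => r n / Complex.exp (Complex.I * (phase a b β₀ n : ℂ)), ?_, fun n => ?_⟩
    · rw [tendsto_zero_iff_norm_tendsto_zero] at hr ⊢
      simpa [norm_exp_I_mul_phase] using hr
    · have := Complex.exp_ne_zero (Complex.I * (phase a b β₀ n : ℂ))
      rw [hf n, Complex.ofReal_one, mul_one]; field_simp; ring

theorem isJostSolution_neg_one_iff {a b : ℕ → ℝ} {β₀ : ℝ} {z : ℂ}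
    {f : ℕ → ℂ} : IsJostSolution a b β₀ (-1) z f ↔
      IsSolution a b z f ∧ HasAsymptotics a b β₀ f 0 1 := by
  have hexp : ∀ n, Complex.exp (Complex.I * ((-1 : ℝ) : ℂ) * (phase a b β₀ n : ℂ))
      = (Complex.exp (Complex.I * (phase a b β₀ n : ℂ)))⁻¹ := fun n => by
    rw [← Complex.exp_neg]; push_cast; ring_nf
  refine and_congr_right fun _ => ⟨?_, ?_⟩
  · rintro ⟨r, hr, hf⟩
    refine ⟨fun n => (Complex.exp (Complex.I * (phase a b β₀ n : ℂ)))⁻¹ * r n, ?_, fun n => ?_⟩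
    · rw [tendsto_zero_iff_norm_tendsto_zero] at hr ⊢
      simpa [norm_exp_I_mul_phase] using hr
    · rw [hf n, hexp, Complex.exp_neg]; ring
  · rintro ⟨r, hr, hf⟩
    refine ⟨fun n => r n * Complex.exp (Complex.I * (phase a b β₀ n : ℂ)), ?_, fun n => ?_⟩
    · rw [tendsto_zero_iff_norm_tendsto_zero] at hr ⊢
      simpa [norm_exp_I_mul_phase] using hr
    · have := Complex.exp_ne_zero (Complex.I * (phase a b β₀ n : ℂ))
      rw [hf n, hexp, Complex.exp_neg]; field_simp; ring

/-! ### The unimodular numbers attached to `β_n` -/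

theorem exp_I_mul_arccos {x : ℝ} (hx : |x| ≤ 1) :
    Complex.exp (Complex.I * (Real.arccos x : ℂ)) = x + √(1 - x ^ 2) * Complex.I := by
  have := abs_le.1 hx
  rw [mul_comm, Complex.exp_mul_I, ← Complex.ofReal_cos, ← Complex.ofReal_sin,
    Real.cos_arccos this.1 this.2, Real.sin_arccos]

theorem inv_exp_I_mul_arccos {x : ℝ} (hx : |x| ≤ 1) :
    (Complex.exp (Complex.I * (Real.arccos x : ℂ)))⁻¹ = x - √(1 - x ^ 2) * Complex.I := by
  have := abs_le.1 hx
  rw [← Complex.exp_neg, ← mul_neg, mul_comm, ← Complex.ofReal_neg, Complex.exp_mul_I,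
    ← Complex.ofReal_cos, ← Complex.ofReal_sin, Real.cos_neg, Real.sin_neg,
    Real.cos_arccos this.1 this.2, Real.sin_arccos]
  push_cast; ring

/-- Transfers bounded variation from `β_n` to `w_n`. The real parts differ by `x - y`; the sines are
compared by rationalising the difference of square roots, which costs `1 / s` because `arccos` is
not Lipschitz near `±1`. -/
theorem norm_exp_I_mul_arccos_sub_le {x y s : ℝ} (hs : 0 < s) (hx : s ≤ √(1 - x ^ 2))
    (hy : s ≤ √(1 - y ^ 2)) :
    ‖Complex.exp (Complex.I * (Real.arccos x : ℂ)) - Complex.exp (Complex.I * (Real.arccos y : ℂ))‖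
      ≤ (1 + 1 / s) * |x - y| := by
  have hx0 : 0 < 1 - x ^ 2 := Real.sqrt_pos.1 (hs.trans_le hx)
  have hy0 : 0 < 1 - y ^ 2 := Real.sqrt_pos.1 (hs.trans_le hy)
  have hx1 : |x| ≤ 1 := ((sq_lt_one_iff_abs_lt_one x).1 (by linarith)).le
  have hy1 : |y| ≤ 1 := ((sq_lt_one_iff_abs_lt_one y).1 (by linarith)).le
  rw [exp_I_mul_arccos hx1, exp_I_mul_arccos hy1]
  have h1 : |√(1 - x ^ 2) - √(1 - y ^ 2)| ≤ 1 / s * |x - y| := by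
    have hprod : (√(1 - x ^ 2) - √(1 - y ^ 2)) * (√(1 - x ^ 2) + √(1 - y ^ 2))
        = (y - x) * (x + y) := by
      have e1 := Real.sq_sqrt hx0.le
      have e2 := Real.sq_sqrt hy0.le
      linear_combination e1 - e2
    have habs := congrArg abs hprod
    rw [abs_mul, abs_mul, abs_sub_comm y x] at habs
    have hxy : |x + y| ≤ 2 := (abs_add_le x y).trans (by linarith)
    have hsum : 2 * s ≤ |√(1 - x ^ 2) + √(1 - y ^ 2)| := by
      rw [abs_of_nonneg (by positivity)]; linarith
    have h2 := mul_le_mul_of_nonneg_left hsum (abs_nonneg (√(1 - x ^ 2) - √(1 - y ^ 2)))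
    have h3 := mul_le_mul_of_nonneg_left hxy (abs_nonneg (x - y))
    rw [one_div_mul_eq_div, le_div_iff₀ hs]
    linarith
  have h2 : (x : ℂ) + √(1 - x ^ 2) * Complex.I - (y + √(1 - y ^ 2) * Complex.I)
      = ((x - y : ℝ) : ℂ) + ((√(1 - x ^ 2) - √(1 - y ^ 2) : ℝ) : ℂ) * Complex.I := by
    push_cast; ring
  rw [h2]
  refine (norm_add_le _ _).trans ?_
  rw [norm_mul, Complex.norm_I, mul_one, Complex.norm_real, Complex.norm_real, Real.norm_eq_abs,
    Real.norm_eq_abs]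
  linarith

theorem exp_phase_succ {a b : ℕ → ℝ} {β₀ : ℝ} {n : ℕ} (h : |beta a b β₀ n| ≤ 1) :
    Complex.exp (Complex.I * (phase a b β₀ (n + 1) : ℂ))
      = Complex.exp (Complex.I * (Real.arccos (beta a b β₀ n) : ℂ))
        * Complex.exp (Complex.I * (phase a b β₀ n : ℂ)) := by
  have : phase a b β₀ (n + 1) = Real.arccos (beta a b β₀ n) + phase a b β₀ n := by
    unfold phase
    rw [Finset.range_add_one, Finset.filter_insert, if_pos h, Finset.sum_insert (by simp)]
  rw [this, Complex.ofReal_add, mul_add, Complex.exp_add]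

/-! ### Reduction of the Jacobi equation to the perturbed recurrence -/

theorem summable_inv_sqrt_mul_sqrt {a : ℕ → ℝ} (ha : ∀ n, 0 < a n)
    (hsum : Summable fun n => (a n)⁻¹) : Summable fun n => (√(a n) * √(a (n + 1)))⁻¹ := by
  refine Summable.of_nonneg_of_le (fun n => by positivity) (fun n => ?_)
    (hsum.add ((summable_nat_add_iff 1).2 hsum))
  have e1 : (√(a n))⁻¹ ^ 2 = (a n)⁻¹ := by rw [inv_pow, Real.sq_sqrt (ha n).le]
  have e2 : (√(a (n + 1)))⁻¹ ^ 2 = (a (n + 1))⁻¹ := by rw [inv_pow, Real.sq_sqrt (ha _).le]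
  rw [mul_inv, ← e1, ← e2]
  nlinarith [sq_nonneg ((√(a n))⁻¹ - (√(a (n + 1)))⁻¹), sq_nonneg (√(a n))⁻¹,
    sq_nonneg (√(a (n + 1)))⁻¹]

/-- The Jacobi equation after the substitution `v_n = a_n^{1/2} u_n`. -/
theorem kRatio_mul_eq {a b : ℕ → ℝ} (ha : ∀ n, 0 < a n) (β₀ : ℝ) (z : ℂ) (u : ℕ → ℂ) (n : ℕ) :
    (kRatio a (n + 1) : ℂ) * (((√(a (n + 2)) : ℝ) : ℂ) * u (n + 2))
      = 2 * (beta a b β₀ (n + 1) : ℂ) * (((√(a (n + 1)) : ℝ) : ℂ) * u (n + 1))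
        - ((√(a n) : ℝ) : ℂ) * u n
        + (jacobiSub a b z u (n + 1) / ((√(a n) : ℝ) : ℂ)
          + z * (((√(a n) * √(a (n + 1)))⁻¹ : ℝ) : ℂ) * (((√(a (n + 1)) : ℝ) : ℂ) * u (n + 1))) := by
  have hk : kRatio a (n + 1) = a (n + 1) / (√(a n) * √(a (n + 2))) := by
    have h1 := Real.mul_self_sqrt (ha (n + 1)).le
    have := Real.sqrt_pos.2 (ha n)
    have := Real.sqrt_pos.2 (ha (n + 1))
    have := Real.sqrt_pos.2 (ha (n + 2))
    simp only [kRatio, alpha, Nat.add_sub_cancel]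
    rw [Real.sqrt_div (ha _).le, Real.sqrt_div (ha _).le]
    nth_rw 3 [← h1]
    field_simp
  have hpos : ∀ m, ((√(a m) : ℝ) : ℂ) ≠ 0 := fun m =>
    Complex.ofReal_ne_zero.2 (Real.sqrt_pos.2 (ha m)).ne'
  have hsq : ∀ m, (a m : ℂ) = ((√(a m) : ℝ) : ℂ) * ((√(a m) : ℝ) : ℂ) := fun m => by
    rw [← Complex.ofReal_mul, Real.mul_self_sqrt (ha m).le]
  have h0 := hpos n
  have h1 := hpos (n + 1)
  have h2 := hpos (n + 2)
  simp only [hk, beta, jacobiSub, jacobi]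
  rw [Real.sqrt_mul (ha _).le]
  push_cast
  rw [hsq n, hsq (n + 1)]
  field_simp
  ring

/-- Every sequence `u` for which `a_{n-1}^{-1/2} ((𝓙 - z) u)_n` is absolutely summable has the
asymptotics of a linear combination of the Jost solutions. -/
theorem exists_hasAsymptotics {a b : ℕ → ℝ} (ha : ∀ n, 0 < a n)
    (hsum : Summable fun n : ℕ => (a n)⁻¹) {β₀ βinf : ℝ}
    (hβ : Tendsto (beta a b β₀) atTop (𝓝 βinf)) (hβinf : |βinf| < 1)
    (hk : Summable fun n : ℕ => |kRatio a (n + 1) - 1|)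
    (hβ' : Summable fun n : ℕ => |beta a b β₀ (n + 1) - beta a b β₀ n|)
    {z : ℂ} {u : ℕ → ℂ}
    (hu : Summable fun n => ‖jacobiSub a b z u (n + 1) / ((√(a n) : ℝ) : ℂ)‖) :
    ∃ s t : ℂ, HasAsymptotics a b β₀ u s t := by
  simp only [hasAsymptotics_iff ha]
  have hpos : 0 < 1 - βinf ^ 2 := by
    have := (sq_lt_one_iff_abs_lt_one βinf).2 hβinf
    linarith
  -- Half the limiting sine: from some `N` on the sines exceed it, hence `|β_n| ≤ 1` and `|w_n -
  -- w_n⁻¹| ≥ 2s`. The recurrence is run from `N` only.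
  set s := √(1 - βinf ^ 2) / 2 with hs
  have hs0 : 0 < s := half_pos (Real.sqrt_pos.2 hpos)
  have hsq : Tendsto (fun n => √(1 - beta a b β₀ n ^ 2)) atTop (𝓝 √(1 - βinf ^ 2)) :=
    (Real.continuous_sqrt.tendsto _).comp (tendsto_const_nhds.sub (hβ.pow 2))
  have hev1 : ∀ᶠ n in atTop, s ≤ √(1 - beta a b β₀ n ^ 2) :=
    (hsq.eventually (lt_mem_nhds (half_lt_self (Real.sqrt_pos.2 hpos)))).mono fun _ h => h.le
  have hev2 : ∀ᶠ n in atTop, |kRatio a (n + 1) - 1| < 1 / 2 :=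
    hk.tendsto_atTop_zero.eventually (gt_mem_nhds (by norm_num))
  obtain ⟨N, hN⟩ := eventually_atTop.1 (hev1.and hev2)
  have hbs : ∀ n, s ≤ √(1 - beta a b β₀ (n + N) ^ 2) := fun n => (hN _ (Nat.le_add_left N n)).1
  have hb1 : ∀ n, |beta a b β₀ (n + N)| ≤ 1 := fun n => by
    have := Real.sqrt_pos.1 (hs0.trans_le (hbs n))
    exact ((sq_lt_one_iff_abs_lt_one _).1 (by linarith)).le
  set w : ℕ → ℂ := fun n =>
    Complex.exp (Complex.I * (Real.arccos (beta a b β₀ (n + N)) : ℂ)) with hw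
  set ε : ℕ → ℝ := fun n => (√(a n) * √(a (n + 1)))⁻¹ with hε
  have hε0 : ∀ n, 0 ≤ ε n := fun n => by positivity
  set v : ℕ → ℂ := fun n => ((√(a n) : ℝ) : ℂ) * u n with hv
  set d : ℕ → ℝ := fun n => ‖jacobiSub a b z u (n + 1) / ((√(a n) : ℝ) : ℂ)‖ with hd
  have hwlim : Tendsto w atTop (𝓝 (Complex.exp (Complex.I * (Real.arccos βinf : ℂ)))) := by
    have hβN := (tendsto_add_atTop_iff_nat N).2 hβ
    have hcont : Continuous fun x : ℝ => Complex.exp (Complex.I * (Real.arccos x : ℂ)) := by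
      have := Real.continuous_arccos
      fun_prop
    exact (hcont.tendsto _).comp hβN
  obtain ⟨x, y, hxy⟩ := exists_tendsto_of_perturbed_recurrence (w := w)
    (e := fun n => Complex.exp (Complex.I * (phase a b β₀ (n + N) : ℂ)))
    (v := fun n => v (n + N))
    -- Solving for `v_{n+2}` divides by `k_{n+1}`, whose absolute value is at least `1 / 2`, and so
    -- doubles every error; the other factor 2 in the 4 comes from `|2β| ≤ 2`.
    (c := fun n => 4 * |kRatio a (n + N + 1) - 1| + 2 * (‖z‖ * ε (n + N)))
    (d := fun n => 2 * d (n + N)) (δ := 2 * s)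
    (by positivity)
    (fun n => by simp only [hw]; rw [mul_comm]; exact Complex.norm_exp_ofReal_mul_I _)
    (fun n => norm_exp_I_mul_phase a b β₀ _)
    (fun n => by
      have := exp_phase_succ (hb1 n)
      rw [add_right_comm] at this
      exact this)
    (fun n => by
      simp only [hw]
      rw [inv_exp_I_mul_arccos (hb1 n), exp_I_mul_arccos (hb1 n)]
      have : ∀ p q : ℂ, p + q * Complex.I - (p - q * Complex.I) = 2 * q * Complex.I := by
        intro p q; ring
      rw [this, norm_mul, norm_mul, Complex.norm_I, Complex.norm_real, Real.norm_eq_abs,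
        abs_of_nonneg (Real.sqrt_nonneg _)]
      have := hbs n
      norm_num
      linarith)
    hwlim
    (Summable.of_nonneg_of_le (fun _ => norm_nonneg _)
      (fun n => norm_exp_I_mul_arccos_sub_le hs0 (hbs (n + 1)) (hbs n))
      (by
        have := ((summable_nat_add_iff N).2 hβ').mul_left (1 + 1 / s)
        refine this.congr fun n => ?_
        rw [add_right_comm n 1 N]))
    (fun n => by have := hε0 (n + N); positivity)
    (fun n => by positivity)
    ((((summable_nat_add_iff N).2 hk).mul_left 4).add
      ((((summable_nat_add_iff N).2 (summable_inv_sqrt_mul_sqrt ha hsum)).mul_left ‖z‖).mul_left 2))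
    (((summable_nat_add_iff N).2 hu).mul_left 2)
    (fun n => by
      have hk2 := (hN (n + N) (Nat.le_add_left N n)).2
      have hwn : w (n + 1) + (w (n + 1))⁻¹ = 2 * (beta a b β₀ (n + N + 1) : ℂ) := by
        simp only [hw]
        rw [inv_exp_I_mul_arccos (hb1 _), exp_I_mul_arccos (hb1 _), add_right_comm n 1 N]
        ring
      have hbn : |beta a b β₀ (n + N + 1)| ≤ 1 := by
        have := hb1 (n + 1)
        rwa [add_right_comm] at this
      rw [hwn]
      have hrec := kRatio_mul_eq (b := b) ha β₀ z u (n + N)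
      rw [add_right_comm n 2 N, add_right_comm n 1 N]
      change (kRatio a (n + N + 1) : ℂ) * v (n + N + 2)
        = 2 * (beta a b β₀ (n + N + 1) : ℂ) * v (n + N + 1) - v (n + N)
          + (jacobiSub a b z u (n + N + 1) / ((√(a (n + N)) : ℝ) : ℂ)
            + z * (ε (n + N) : ℂ) * v (n + N + 1)) at hrec
      generalize n + N = m at *
      set κ := kRatio a (m + 1)
      set B := beta a b β₀ (m + 1)
      set δ := v (m + 2) - 2 * (B : ℂ) * v (m + 1) + v m
      have hδ : (κ : ℂ) * δ = ((1 - κ : ℝ) : ℂ) * (2 * (B : ℂ) * v (m + 1) - v m)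
          + (jacobiSub a b z u (m + 1) / ((√(a m) : ℝ) : ℂ)
            + z * (ε m : ℂ) * v (m + 1)) := by
        push_cast
        linear_combination hrec
      have hκ : 1 / 2 ≤ |κ| := by
        have := abs_lt.1 hk2
        rw [abs_of_pos] <;> linarith
      have h1 : ‖(κ : ℂ) * δ‖ ≤ |κ - 1| * (2 * ‖v (m + 1)‖ + ‖v m‖)
          + (d m + ‖z‖ * ε m * ‖v (m + 1)‖) := by
        rw [hδ]
        refine (norm_add_le _ _).trans (add_le_add ?_ ((norm_add_le _ _).trans
          (add_le_add le_rfl ?_)))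
        · rw [norm_mul, Complex.norm_real, Real.norm_eq_abs, abs_sub_comm]
          refine mul_le_mul_of_nonneg_left ((norm_sub_le _ _).trans (add_le_add ?_ le_rfl))
            (abs_nonneg _)
          rw [norm_mul, norm_mul, Complex.norm_real, Real.norm_eq_abs, Complex.norm_ofNat]
          have := mul_le_mul_of_nonneg_right hbn (norm_nonneg (v (m + 1)))
          linarith
        · rw [norm_mul, norm_mul, Complex.norm_real, Real.norm_eq_abs, abs_of_nonneg (hε0 m)]
      rw [norm_mul, Complex.norm_real, Real.norm_eq_abs] at h1
      have h2 := mul_le_mul_of_nonneg_right hκ (norm_nonneg δ)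
      have h3 : 0 ≤ |κ - 1| * ‖v m‖ := by positivity
      have h4 : 0 ≤ ‖z‖ * ε m * ‖v m‖ := by have := hε0 m; positivity
      linarith)
  exact ⟨x, y, (tendsto_add_atTop_iff_nat N).1 hxy⟩

/-! ### Solutions, the polynomials and the Wronskian -/

theorem isSolution_iff {a b : ℕ → ℝ} {z : ℂ} {u : ℕ → ℂ} :
    IsSolution a b z u ↔ ∀ n, jacobiSub a b z u (n + 1) = 0 := by
  constructor
  · exact fun h n => sub_eq_zero.2 (h (n + 1) (Nat.le_add_left 1 n))
  · rintro h (_ | n) hn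
    · omega
    · exact sub_eq_zero.1 (h n)

theorem jacobiSub_linear_combination (a b : ℕ → ℝ) (z : ℂ) (u v : ℕ → ℂ) (x y : ℂ) (n : ℕ) :
    jacobiSub a b z (fun n => x * u n + y * v n) n
      = x * jacobiSub a b z u n + y * jacobiSub a b z v n := by
  cases n <;> simp only [jacobiSub, jacobi] <;> ring

theorem IsSolution.linear_combination {a b : ℕ → ℝ} {z : ℂ} {u v : ℕ → ℂ}
    (hu : IsSolution a b z u) (hv : IsSolution a b z v) (x y : ℂ) :
    IsSolution a b z fun n => x * u n + y * v n := by
  rw [isSolution_iff] at *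
  intro n
  rw [jacobiSub_linear_combination, hu, hv, mul_zero, mul_zero, add_zero]

theorem IsSolution.ext {a b : ℕ → ℝ} (ha : ∀ n, 0 < a n) {z : ℂ} {u v : ℕ → ℂ}
    (hu : IsSolution a b z u) (hv : IsSolution a b z v) (h0 : u 0 = v 0) (h1 : u 1 = v 1) :
    u = v := by
  have key : ∀ n, u n = v n ∧ u (n + 1) = v (n + 1) := by
    intro n
    induction n with
    | zero => exact ⟨h0, h1⟩
    | succ n ih =>
      refine ⟨ih.2, ?_⟩
      have e1 := hu (n + 1) (Nat.le_add_left 1 n)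
      have e2 := hv (n + 1) (Nat.le_add_left 1 n)
      rw [Nat.add_sub_cancel] at e1 e2
      rw [ih.1, ih.2] at e1
      refine mul_left_cancel₀ (Complex.ofReal_ne_zero.2 (ha (n + 1)).ne') ?_
      linear_combination e1 - e2
  exact funext fun n => (key n).1

theorem isSolution_polyP {a b : ℕ → ℝ} (ha : ∀ n, 0 < a n) (z : ℂ) :
    IsSolution a b z (polyP a b z) := by
  rintro (_ | n) hn
  · omega
  · have : (a (n + 1) : ℂ) ≠ 0 := Complex.ofReal_ne_zero.2 (ha (n + 1)).ne'
    rw [Nat.add_sub_cancel, polyP, mul_div_cancel₀ _ this]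
    ring

theorem isSolution_polyQ {a b : ℕ → ℝ} (ha : ∀ n, 0 < a n) (z : ℂ) :
    IsSolution a b z (polyQ a b z) := by
  rintro (_ | n) hn
  · omega
  · have : (a (n + 1) : ℂ) ≠ 0 := Complex.ofReal_ne_zero.2 (ha (n + 1)).ne'
    rw [Nat.add_sub_cancel, polyQ, mul_div_cancel₀ _ this]
    ring

/-- `p` satisfies row 0 as well, while `q` misses it by exactly 1; so the row 0 defect of `u` is its
coefficient at `q`. -/
theorem IsSolution.eq_polyP_add_polyQ {a b : ℕ → ℝ} (ha : ∀ n, 0 < a n) {z : ℂ} {u : ℕ → ℂ}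
    (hu : IsSolution a b z u) :
    u = fun n => u 0 * polyP a b z n + jacobiSub a b z u 0 * polyQ a b z n := by
  have h0 : (a 0 : ℂ) ≠ 0 := Complex.ofReal_ne_zero.2 (ha 0).ne'
  refine hu.ext ha ((isSolution_polyP ha z).linear_combination (isSolution_polyQ ha z) _ _) ?_ ?_
  · simp [polyP, polyQ]
  · simp only [polyP, polyQ, jacobiSub, jacobi]
    field_simp
    ring

/-- `p(z)` and `q(z)` are linearly independent. -/
theorem eq_zero_of_polyP_polyQ_combination {a b : ℕ → ℝ} (ha : ∀ n, 0 < a n) {z x y : ℂ}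
    (h : ∀ n, x * polyP a b z n + y * polyQ a b z n = 0) : x = 0 ∧ y = 0 := by
  have h0 : (a 0 : ℂ) ≠ 0 := Complex.ofReal_ne_zero.2 (ha 0).ne'
  have hx : x = 0 := by simpa [polyP, polyQ] using h 0
  subst hx
  have h1 := h 1
  simp only [polyQ, zero_mul, zero_add, mul_one_div, div_eq_zero_iff, h0, or_false] at h1
  exact ⟨rfl, h1⟩

theorem IsSolution.wronskian_eq {a b : ℕ → ℝ} {z : ℂ} {u v : ℕ → ℂ}
    (hu : IsSolution a b z u) (hv : IsSolution a b z v) (n : ℕ) :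
    (a n : ℂ) * (u n * v (n + 1) - u (n + 1) * v n)
      = (a 0 : ℂ) * (u 0 * v 1 - u 1 * v 0) := by
  induction n with
  | zero => rfl
  | succ n ih =>
    have e1 := hu (n + 1) (Nat.le_add_left 1 n)
    have e2 := hv (n + 1) (Nat.le_add_left 1 n)
    rw [Nat.add_sub_cancel] at e1 e2
    rw [← ih]
    linear_combination u (n + 1) * e2 - v (n + 1) * e1

theorem wronskian_polyP_polyQ {a b : ℕ → ℝ} (ha : ∀ n, 0 < a n) (z : ℂ) (n : ℕ) :
    (a n : ℂ) * (polyP a b z n * polyQ a b z (n + 1) - polyP a b z (n + 1) * polyQ a b z n) = 1 := by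
  have h0 : (a 0 : ℂ) ≠ 0 := Complex.ofReal_ne_zero.2 (ha 0).ne'
  rw [(isSolution_polyP ha z).wronskian_eq (isSolution_polyQ ha z)]
  simp [polyP, polyQ, h0]

/-- An eventually decreasing `a_n` would keep `1 / a_n` away from 0. At these indices `a_n ≤ √a_n
√a_{n+1}`, which lets the Wronskian be bounded by the rescaled solutions. -/
theorem frequently_le_succ {a : ℕ → ℝ} (ha : ∀ n, 0 < a n)
    (hsum : Summable fun n : ℕ => (a n)⁻¹) : ∃ᶠ n in atTop, a n ≤ a (n + 1) := by
  intro h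
  obtain ⟨N, hN⟩ := eventually_atTop.1 h
  have hle : ∀ n, N ≤ n → a n ≤ a N := by
    intro n hn
    induction n, hn using Nat.le_induction with
    | base => exact le_rfl
    | succ n hn ih => exact (not_le.1 (hN n hn)).le.trans ih
  have h1 : (a N)⁻¹ ≤ 0 := ge_of_tendsto hsum.tendsto_atTop_zero
    (eventually_atTop.2 ⟨N, fun n hn => inv_anti₀ (ha n) (hle n hn)⟩)
  exact absurd (inv_pos.2 (ha N)) (not_lt.2 h1)

/-- The Wronskian of a solution of size `o(a_n^{-1/2})` with one of size `O(a_n^{-1/2})`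
vanishes. -/
theorem IsSolution.wronskian_eq_zero {a b : ℕ → ℝ} (ha : ∀ n, 0 < a n)
    (hsum : Summable fun n : ℕ => (a n)⁻¹) {z : ℂ} {u v : ℕ → ℂ}
    (hu : IsSolution a b z u) (hv : IsSolution a b z v)
    (hu0 : Tendsto (fun n => ((√(a n) : ℝ) : ℂ) * u n) atTop (𝓝 0))
    {C : ℝ} (hC : ∀ n, ‖((√(a n) : ℝ) : ℂ) * v n‖ ≤ C) :
    (a 0 : ℂ) * (u 0 * v 1 - u 1 * v 0) = 0 := by
  set U : ℕ → ℂ := fun n => ((√(a n) : ℝ) : ℂ) * u n with hU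
  have hlim : Tendsto (fun n => ‖U n‖ * C + ‖U (n + 1)‖ * C) atTop (𝓝 0) := by
    have h1 := hu0.norm.mul_const C
    have h2 := h1.add ((tendsto_add_atTop_iff_nat 1).2 h1)
    simpa using h2
  by_contra hne
  have hpos := norm_pos_iff.2 hne
  obtain ⟨n, hn, hlt⟩ := ((frequently_le_succ ha hsum).and_eventually
    (hlim.eventually (gt_mem_nhds hpos))).exists
  rw [← hu.wronskian_eq hv n] at hlt
  refine absurd hlt (not_lt.2 ?_)
  have h1 : a n ≤ √(a n) * √(a (n + 1)) := by
    nth_rw 1 [← Real.mul_self_sqrt (ha n).le]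
    exact mul_le_mul_of_nonneg_left (Real.sqrt_le_sqrt hn) (Real.sqrt_nonneg _)
  calc ‖(a n : ℂ) * (u n * v (n + 1) - u (n + 1) * v n)‖
      = a n * ‖u n * v (n + 1) - u (n + 1) * v n‖ := by
        rw [norm_mul, Complex.norm_real, Real.norm_eq_abs, abs_of_pos (ha n)]
    _ ≤ √(a n) * √(a (n + 1)) * ‖u n * v (n + 1) - u (n + 1) * v n‖ :=
        mul_le_mul_of_nonneg_right h1 (norm_nonneg _)
    _ = ‖U n * (((√(a (n + 1)) : ℝ) : ℂ) * v (n + 1))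
          - U (n + 1) * (((√(a n) : ℝ) : ℂ) * v n)‖ := by
        rw [← abs_of_nonneg (show 0 ≤ √(a n) * √(a (n + 1)) by positivity), ← Real.norm_eq_abs,
          ← Complex.norm_real, ← norm_mul]
        congr 1
        simp only [hU]
        push_cast
        ring
    _ ≤ ‖U n‖ * C + ‖U (n + 1)‖ * C := by
        refine (norm_sub_le _ _).trans ?_
        rw [norm_mul, norm_mul (U (n + 1))]
        gcongr
        · exact hC _
        · exact hC _

/-! ### Square summability -/

theorem memℓp_two_iff {u : ℕ → ℂ} : Memℓp u 2 ↔ Summable fun n => ‖u n‖ ^ 2 := by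
  rw [memℓp_gen_iff (by norm_num)]
  simp

theorem summable_norm_mul_of_summable_sq {u v : ℕ → ℂ} (hu : Summable fun n => ‖u n‖ ^ 2)
    (hv : Summable fun n => ‖v n‖ ^ 2) : Summable fun n => ‖u n * v n‖ := by
  refine Summable.of_nonneg_of_le (fun _ => norm_nonneg _) (fun n => ?_) (hu.add hv)
  rw [norm_mul]
  nlinarith [sq_nonneg (‖u n‖ - ‖v n‖), sq_nonneg ‖u n‖, sq_nonneg ‖v n‖]

theorem HasAsymptotics.memℓp {a b : ℕ → ℝ} (ha : ∀ n, 0 < a n)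
    (hsum : Summable fun n : ℕ => (a n)⁻¹) {β₀ : ℝ} {u : ℕ → ℂ} {s t : ℂ}
    (hu : HasAsymptotics a b β₀ u s t) : Memℓp u 2 := by
  obtain ⟨C, hC⟩ := hu.norm_le ha
  rw [memℓp_two_iff]
  refine Summable.of_nonneg_of_le (fun _ => by positivity) (fun n => ?_) (hsum.mul_left (C ^ 2))
  have h1 := pow_le_pow_left₀ (norm_nonneg _) (hC n) 2
  rw [norm_mul, Complex.norm_real, mul_pow, Real.norm_eq_abs, sq_abs, Real.sq_sqrt (ha n).le] at h1
  rw [← div_eq_mul_inv, le_div_iff₀ (ha n)]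
  linarith

theorem memℓp_jacobiSub {a b : ℕ → ℝ} {u : ℕ → ℂ} (hu : u ∈ maxDomain a b) (z : ℂ) :
    Memℓp (jacobiSub a b z u) 2 :=
  hu.2.sub (hu.1.const_mul z)

theorem summable_jacobiSub_div_sqrt {a b : ℕ → ℝ} (ha : ∀ n, 0 < a n)
    (hsum : Summable fun n : ℕ => (a n)⁻¹) {z : ℂ} {u : ℕ → ℂ}
    (hu : Memℓp (jacobiSub a b z u) 2) :
    Summable fun n => ‖jacobiSub a b z u (n + 1) / ((√(a n) : ℝ) : ℂ)‖ := by
  refine summable_norm_mul_of_summable_sq ((summable_nat_add_iff 1).2 (memℓp_two_iff.1 hu))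
    (hsum.congr fun n => ?_)
  rw [norm_inv, Complex.norm_real, Real.norm_eq_abs, inv_pow, sq_abs, Real.sq_sqrt (ha n).le]

/-! ### The quasiresolvent -/

/-- The Jacobi coefficients are real; this turns `⟨h, p(z̄)⟩` into `∑ p_n(z) h_n`. -/
theorem conj_polyP_conj (a b : ℕ → ℝ) (z : ℂ) :
    ∀ n, (starRingEnd ℂ) (polyP a b ((starRingEnd ℂ) z) n) = polyP a b z n
  | 0 => by simp [polyP]
  | 1 => by simp [polyP]
  | n + 2 => by simp [polyP, conj_polyP_conj a b z n, conj_polyP_conj a b z (n + 1)]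

/-- The quasiresolvent is a right inverse of `𝓙 - z`. -/
theorem jacobiSub_quasiResolvent {a b : ℕ → ℝ} (ha : ∀ n, 0 < a n) {z : ℂ} {h : ℕ → ℂ}
    (hh : Summable fun n => polyQ a b z n * h n) (n : ℕ) :
    jacobiSub a b z (quasiResolvent a b z h) n = h n := by
  set p := polyP a b z with hp
  set q := polyQ a b z with hq
  have htail : ∀ n, ∑' m, q (n + 1 + m) * h (n + 1 + m)
      = q (n + 1) * h (n + 1) + ∑' m, q (n + 1 + 1 + m) * h (n + 1 + 1 + m) := by
    intro n
    have hs : Summable fun m => q (n + 1 + m) * h (n + 1 + m) := by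
      simpa only [add_comm] using (summable_nat_add_iff (n + 1)).2 hh
    rw [hs.tsum_eq_zero_add, add_zero]
    simp only [add_assoc, add_comm 1]
  have hW := wronskian_polyP_polyQ (b := b) ha z
  cases n with
  | zero =>
    have h0 : (a 0 : ℂ) ≠ 0 := Complex.ofReal_ne_zero.2 (ha 0).ne'
    simp only [jacobiSub, jacobi, quasiResolvent, ← hp, ← hq]
    rw [htail 0, Finset.sum_range_succ _ 1, Finset.sum_range_one]
    simp only [hp, hq, polyP, polyQ, zero_add]
    field_simp
    ring
  | succ n =>
    have e1 := isSolution_polyP (b := b) ha z (n + 1) (Nat.le_add_left 1 n)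
    have e2 := isSolution_polyQ (b := b) ha z (n + 1) (Nat.le_add_left 1 n)
    rw [Nat.add_sub_cancel] at e1 e2
    have hWn := hW n
    simp only [jacobiSub, jacobi, quasiResolvent, ← hp, ← hq] at e1 e2 hWn ⊢
    rw [htail n, htail (n + 1), Finset.sum_range_succ _ (n + 2), Finset.sum_range_succ _ (n + 1)]
    set T := ∑' m, q (n + 1 + 1 + 1 + m) * h (n + 1 + 1 + 1 + m)
    set S := ∑ m ∈ Finset.range (n + 1), p m * h m
    -- At `n + 1` and `n + 2` the quasiresolvent agrees with one fixed combination of `q` and `p`;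
    -- at `n` it differs by `h (n + 1)` times the Wronskian bracket, which produces the right-hand
    -- side.
    linear_combination (S + p (n + 1) * h (n + 1)) * e2
      + (q (n + 2) * h (n + 2) + T) * e1 + h (n + 1) * hWn

/-- The quasiresolvent maps into sequences asymptotically proportional to `q(z)`. -/
theorem hasAsymptotics_quasiResolvent {a b : ℕ → ℝ} (ha : ∀ n, 0 < a n) {β₀ : ℝ} {z : ℂ}
    {h : ℕ → ℂ} {s t s' t' : ℂ} (hp : HasAsymptotics a b β₀ (polyP a b z) s' t')
    (hq : HasAsymptotics a b β₀ (polyQ a b z) s t)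
    (hph : Summable fun n => polyP a b z n * h n) :
    HasAsymptotics a b β₀ (quasiResolvent a b z h)
      ((∑' n, polyP a b z n * h n) * s) ((∑' n, polyP a b z n * h n) * t) := by
  set S := ∑' n, polyP a b z n * h n
  obtain ⟨C, hC⟩ := hp.norm_le ha
  obtain ⟨D, hD⟩ := hq.norm_le ha
  have hS : Tendsto (fun n => ∑ m ∈ Finset.range (n + 1), polyP a b z m * h m - S) atTop
      (𝓝 0) :=
    tendsto_sub_nhds_zero_iff.2 ((tendsto_add_atTop_iff_nat 1).2 hph.hasSum.tendsto_sum_nat)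
  have hT : Tendsto (fun n => ∑' m, polyQ a b z (n + 1 + m) * h (n + 1 + m)) atTop (𝓝 0) := by
    have := (tendsto_add_atTop_iff_nat 1).2
      (tendsto_sum_nat_add fun m => polyQ a b z m * h m)
    simpa only [add_comm] using this
  have h1 : Tendsto (fun n => (((√(a n) : ℝ) : ℂ) * polyQ a b z n)
      * (∑ m ∈ Finset.range (n + 1), polyP a b z m * h m - S)) atTop (𝓝 0) :=
    isBoundedUnder_le_mul_tendsto_zero (isBoundedUnder_of ⟨D, hD⟩) hS
  have h2 : Tendsto (fun n => (((√(a n) : ℝ) : ℂ) * polyP a b z n)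
      * ∑' m, polyQ a b z (n + 1 + m) * h (n + 1 + m)) atTop (𝓝 0) :=
    isBoundedUnder_le_mul_tendsto_zero (isBoundedUnder_of ⟨C, hC⟩) hT
  rw [hasAsymptotics_iff ha] at hq ⊢
  have h3 := ((hq.const_mul S).add h1).add h2
  simp only [mul_zero, add_zero] at h3
  refine h3.congr fun n => ?_
  simp only [quasiResolvent]
  ring

/-! ### Uniqueness of solutions and of asymptotic coefficients -/

theorem HasAsymptotics.tendsto_zero {a b : ℕ → ℝ} (ha : ∀ n, 0 < a n) {β₀ : ℝ} {u : ℕ → ℂ}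
    (hu : HasAsymptotics a b β₀ u 0 0) :
    Tendsto (fun n => ((√(a n) : ℝ) : ℂ) * u n) atTop (𝓝 0) := by
  simpa using (hasAsymptotics_iff ha).1 hu

/-- A solution of size `o(a_n^{-1/2})` vanishes, provided that `p(z)`, `q(z)` have asymptotics. -/
theorem IsSolution.eq_zero {a b : ℕ → ℝ} (ha : ∀ n, 0 < a n)
    (hsum : Summable fun n : ℕ => (a n)⁻¹) {β₀ : ℝ} {z : ℂ} {u : ℕ → ℂ} {s t s' t' : ℂ}
    (hp : HasAsymptotics a b β₀ (polyP a b z) s t) (hq : HasAsymptotics a b β₀ (polyQ a b z) s' t')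
    (hu : IsSolution a b z u) (hu0 : HasAsymptotics a b β₀ u 0 0) (n : ℕ) : u n = 0 := by
  have h0 : (a 0 : ℂ) ≠ 0 := Complex.ofReal_ne_zero.2 (ha 0).ne'
  obtain ⟨C, hC⟩ := hp.norm_le ha
  obtain ⟨D, hD⟩ := hq.norm_le ha
  have e1 := hu.wronskian_eq_zero ha hsum (isSolution_polyP ha z) (hu0.tendsto_zero ha) hC
  have e2 := hu.wronskian_eq_zero ha hsum (isSolution_polyQ ha z) (hu0.tendsto_zero ha) hD
  have hu00 : u 0 = 0 := by simpa [polyQ, h0] using e2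
  have hu1 : u 1 = 0 := by simpa [polyP, h0, hu00] using e1
  have hz : IsSolution a b z fun _ => 0 := fun n _ => by simp
  exact congrFun (hu.ext ha hz hu00 hu1) n

/-- The matrix of the asymptotic coefficients of `p(z)`, `q(z)` is invertible. -/
theorem det_asymptotics_ne_zero {a b : ℕ → ℝ} (ha : ∀ n, 0 < a n)
    (hsum : Summable fun n : ℕ => (a n)⁻¹) {β₀ : ℝ} {z s t s' t' : ℂ}
    (hp : HasAsymptotics a b β₀ (polyP a b z) s t)
    (hq : HasAsymptotics a b β₀ (polyQ a b z) s' t') : s * t' - t * s' ≠ 0 := by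
  intro hD
  have key : ∀ x y : ℂ, x * s + y * s' = 0 → x * t + y * t' = 0 → x = 0 ∧ y = 0 := by
    intro x y h1 h2
    have hasy := hp.linear_combination ha hq x y
    rw [h1, h2] at hasy
    exact eq_zero_of_polyP_polyQ_combination ha (IsSolution.eq_zero ha hsum hp hq
      ((isSolution_polyP ha z).linear_combination (isSolution_polyQ ha z) x y) hasy)
  -- With zero determinant, `(s', -s)` and `(t', -t)` are killed by the coefficient matrix, forcing
  -- `s = t = 0`; then `(1, 0)` is killed too.
  have h1 := key s' (-s) (by ring) (by linear_combination -hD)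
  have h2 := key t' (-t) (by linear_combination hD) (by ring)
  exact one_ne_zero (key 1 0 (by linear_combination -h1.2) (by linear_combination -h2.2)).1

/-- Here `u` need not solve anything. Two expansions of it give the zero sequence an expansion `(c,
d)`; a combination of `p`, `q` sharing that expansion up to the determinant is then negligible,
hence zero, so `c = d = 0`. No analysis of the phases is needed. -/
theorem HasAsymptotics.unique {a b : ℕ → ℝ} (ha : ∀ n, 0 < a n)
    (hsum : Summable fun n : ℕ => (a n)⁻¹) {β₀ : ℝ} {z s t s' t' : ℂ}
    (hp : HasAsymptotics a b β₀ (polyP a b z) s t)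
    (hq : HasAsymptotics a b β₀ (polyQ a b z) s' t') {u : ℕ → ℂ} {x y x' y' : ℂ}
    (hu : HasAsymptotics a b β₀ u x y) (hu' : HasAsymptotics a b β₀ u x' y') :
    x = x' ∧ y = y' := by
  have hD := det_asymptotics_ne_zero ha hsum hp hq
  have hzero := hu.linear_combination ha hu' 1 (-1)
  set c := 1 * x + -1 * x' with hc
  set d := 1 * y + -1 * y' with hd
  -- Cramer's rule without division: the asymptotic coefficients are the determinant times `(c, d)`.
  have hpq := hp.linear_combination ha hq (c * t' - d * s') (d * s - c * t)
  have hdiff := hpq.linear_combination ha hzero 1 (-(s * t' - t * s'))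
  have e1 : 1 * ((c * t' - d * s') * s + (d * s - c * t) * s') + -(s * t' - t * s') * c = 0 := by
    ring
  have e2 : 1 * ((c * t' - d * s') * t + (d * s - c * t) * t') + -(s * t' - t * s') * d = 0 := by
    ring
  rw [e1, e2] at hdiff
  have hpq0 := IsSolution.eq_zero ha hsum hp hq ((isSolution_polyP ha z).linear_combination
    (isSolution_polyQ ha z) (c * t' - d * s') (d * s - c * t))
    (by simpa only [one_mul, neg_mul, add_neg_cancel, mul_zero, neg_zero, add_zero] using hdiff)
  obtain ⟨h1, h2⟩ := eq_zero_of_polyP_polyQ_combination ha hpq0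
  have hc0 : c = 0 := (mul_eq_zero.1 (show (s * t' - t * s') * c = 0 by
    linear_combination s * h1 + s' * h2)).resolve_left hD
  have hd0 : d = 0 := (mul_eq_zero.1 (show (s * t' - t * s') * d = 0 by
    linear_combination t * h1 + t' * h2)).resolve_left hD
  exact ⟨by linear_combination hc0 - hc, by linear_combination hd0 - hd⟩

/-- `u = G p(z) + R(z)(𝓙 - z)u` holds for exactly one constant `G`. -/
theorem exists_forall_eq_polyP_add_quasiResolvent_iff {a b : ℕ → ℝ} (ha : ∀ n, 0 < a n) {z : ℂ}
    {u : ℕ → ℂ} (hq : Summable fun n => polyQ a b z n * jacobiSub a b z u n) :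
    ∃ Γ : ℂ, ∀ G : ℂ, (∀ n : ℕ, u n = G * polyP a b z n
      + quasiResolvent a b z (jacobiSub a b z u) n) ↔ G = Γ := by
  set R := quasiResolvent a b z (jacobiSub a b z u) with hR
  have hw : ∀ n, jacobiSub a b z (fun n => 1 * u n + -1 * R n) n = 0 := fun n => by
    rw [jacobiSub_linear_combination, hR, jacobiSub_quasiResolvent ha hq]
    ring
  -- Forced by `p_0 = 1`. It works because `u - R` has no row 0 defect, hence no `q` component.
  refine ⟨u 0 - R 0, fun G => ⟨fun h => ?_, ?_⟩⟩
  · rw [h 0, polyP]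
    ring
  · rintro rfl n
    have hsol : IsSolution a b z fun n => 1 * u n + -1 * R n := isSolution_iff.2 fun n => hw _
    have := congrFun (hsol.eq_polyP_add_polyQ ha) n
    simp only [hw 0] at this
    linear_combination this

end JacobiLC

/-! ### The main theorem -/

theorem theorem3p5 (a b : ℕ → ℝ) (ha : ∀ n, 0 < a n)
    (hsum : Summable (fun n : ℕ => (a n)⁻¹))
    (β₀ βinf : ℝ)
    (hβ : Tendsto (JacobiLC.beta a b β₀) atTop (𝓝 βinf)) (hβinf : |βinf| < 1)
    (hk : Summable (fun n : ℕ => |JacobiLC.kRatio a (n + 1) - 1|))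
    (hβ' : Summable (fun n : ℕ => |JacobiLC.beta a b β₀ (n + 1) - JacobiLC.beta a b β₀ n|)) :
    (∀ z : ℂ, Memℓp (JacobiLC.polyP a b z) 2 ∧ Memℓp (JacobiLC.polyQ a b z) 2) ∧
    ∃ (fp fm : ℂ → ℕ → ℂ) (σp σm τp τm : ℂ → ℂ),
      -- `fp z`, `fm z` are the unique Jost solutions
      (∀ (z : ℂ) (g : ℕ → ℂ), JacobiLC.IsJostSolution a b β₀ 1 z g ↔ g = fp z) ∧
      (∀ (z : ℂ) (g : ℕ → ℂ), JacobiLC.IsJostSolution a b β₀ (-1) z g ↔ g = fm z) ∧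
      -- `σp z`, `σm z`, `τp z`, `τm z` are the unique coefficients of `p(z)`, `q(z)` in them
      (∀ z x y : ℂ, (∀ n : ℕ, JacobiLC.polyP a b z n = x * fp z n + y * fm z n) ↔
        x = σp z ∧ y = σm z) ∧
      (∀ z x y : ℂ, (∀ n : ℕ, JacobiLC.polyQ a b z n = x * fp z n + y * fm z n) ↔
        x = τp z ∧ y = τm z) ∧
      -- asymptotics of all vectors of the maximal domain
      (∀ u ∈ JacobiLC.maxDomain a b, ∃ sp sm : ℂ,
        JacobiLC.HasAsymptotics a b β₀ u sp sm ∧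
        ∀ z : ℂ, ∃ Γ : ℂ,
          (∀ G : ℂ, (∀ n : ℕ, u n = G * JacobiLC.polyP a b z n
              + JacobiLC.quasiResolvent a b z (JacobiLC.jacobiSub a b z u) n) ↔ G = Γ) ∧
          sp = Γ * σp z
            + JacobiLC.l2Inner (JacobiLC.jacobiSub a b z u)
                (JacobiLC.polyP a b ((starRingEnd ℂ) z)) * τp z ∧
          sm = Γ * σm z
            + JacobiLC.l2Inner (JacobiLC.jacobiSub a b z u)
                (JacobiLC.polyP a b ((starRingEnd ℂ) z)) * τm z) ∧
      -- every pair of coefficients is attained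
      (∀ sp sm : ℂ, ∃ u ∈ JacobiLC.maxDomain a b, JacobiLC.HasAsymptotics a b β₀ u sp sm) := by
  have hP : ∀ z, ∃ s t, JacobiLC.HasAsymptotics a b β₀ (JacobiLC.polyP a b z) s t := fun z =>
    JacobiLC.exists_hasAsymptotics ha hsum hβ hβinf hk hβ' (z := z) (by
      simp [JacobiLC.isSolution_iff.1 (JacobiLC.isSolution_polyP ha z)])
  have hQ : ∀ z, ∃ s t, JacobiLC.HasAsymptotics a b β₀ (JacobiLC.polyQ a b z) s t := fun z =>
    JacobiLC.exists_hasAsymptotics ha hsum hβ hβinf hk hβ' (z := z) (by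
      simp [JacobiLC.isSolution_iff.1 (JacobiLC.isSolution_polyQ ha z)])
  choose σp σm hσ using hP
  choose τp τm hτ using hQ
  have hD : ∀ z, σp z * τm z - σm z * τp z ≠ 0 := fun z =>
    JacobiLC.det_asymptotics_ne_zero ha hsum (hσ z) (hτ z)
  set D : ℂ → ℂ := fun z => σp z * τm z - σm z * τp z
  -- The rows of the inverse coefficient matrix, so that the asymptotics become `(1, 0)` and `(0,
  -- 1)`.
  set fp : ℂ → ℕ → ℂ := fun z n =>
    τm z / D z * JacobiLC.polyP a b z n + -σm z / D z * JacobiLC.polyQ a b z n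
  set fm : ℂ → ℕ → ℂ := fun z n =>
    -τp z / D z * JacobiLC.polyP a b z n + σp z / D z * JacobiLC.polyQ a b z n
  have hsol : ∀ z x y, JacobiLC.IsSolution a b z
      fun n => x * JacobiLC.polyP a b z n + y * JacobiLC.polyQ a b z n := fun z x y =>
    (JacobiLC.isSolution_polyP ha z).linear_combination (JacobiLC.isSolution_polyQ ha z) x y
  have hfpA : ∀ z, JacobiLC.HasAsymptotics a b β₀ (fp z) 1 0 := fun z => by
    convert (hσ z).linear_combination ha (hτ z) (τm z / D z) (-σm z / D z) using 1
    · have := hD z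
      rw [div_mul_eq_mul_div, div_mul_eq_mul_div, ← add_div, eq_comm, div_eq_one_iff_eq this]
      ring
    · ring
  have hfmA : ∀ z, JacobiLC.HasAsymptotics a b β₀ (fm z) 0 1 := fun z => by
    convert (hσ z).linear_combination ha (hτ z) (-τp z / D z) (σp z / D z) using 1
    · ring
    · have := hD z
      rw [div_mul_eq_mul_div, div_mul_eq_mul_div, ← add_div, eq_comm, div_eq_one_iff_eq this]
      ring
  have heq : ∀ (z : ℂ) (f g : ℕ → ℂ) (s t : ℂ), JacobiLC.IsSolution a b z f →
      JacobiLC.IsSolution a b z g → JacobiLC.HasAsymptotics a b β₀ f s t →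
      JacobiLC.HasAsymptotics a b β₀ g s t → f = g := by
    intro z f g s t hf hg hfA hgA
    have hA := hfA.linear_combination ha hgA 1 (-1)
    rw [show 1 * s + -1 * s = 0 by ring, show 1 * t + -1 * t = 0 by ring] at hA
    funext n
    have := JacobiLC.IsSolution.eq_zero ha hsum (hσ z) (hτ z) (hf.linear_combination hg 1 (-1)) hA n
    linear_combination this
  have hunique : ∀ (z : ℂ) {u : ℕ → ℂ} {x y x' y' : ℂ}, JacobiLC.HasAsymptotics a b β₀ u x y →
      JacobiLC.HasAsymptotics a b β₀ u x' y' → x = x' ∧ y = y' := fun z _ _ _ _ _ h h' =>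
    JacobiLC.HasAsymptotics.unique ha hsum (hσ z) (hτ z) h h'
  have hcomb : ∀ z x y, JacobiLC.HasAsymptotics a b β₀ (fun n => x * fp z n + y * fm z n) x y :=
    fun z x y => by
      simpa using (hfpA z).linear_combination ha (hfmA z) x y
  refine ⟨fun z => ⟨(hσ z).memℓp ha hsum, (hτ z).memℓp ha hsum⟩, fp, fm, σp, σm, τp, τm,
    fun z g => ?_, fun z g => ?_, fun z x y => ?_, fun z x y => ?_, fun u hu => ?_, fun sp sm => ?_⟩
  · rw [JacobiLC.isJostSolution_one_iff]
    refine ⟨fun h => heq z g _ 1 0 h.1 (hsol z _ _) h.2 (hfpA z), ?_⟩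
    rintro rfl
    exact ⟨hsol z _ _, hfpA z⟩
  · rw [JacobiLC.isJostSolution_neg_one_iff]
    refine ⟨fun h => heq z g _ 0 1 h.1 (hsol z _ _) h.2 (hfmA z), ?_⟩
    rintro rfl
    exact ⟨hsol z _ _, hfmA z⟩
  · refine ⟨fun h => hunique z (by rw [funext h]; exact hcomb z x y) (hσ z), ?_⟩
    rintro ⟨rfl, rfl⟩
    exact congrFun (heq z _ _ _ _ (JacobiLC.isSolution_polyP ha z)
      ((hsol z _ _).linear_combination (hsol z _ _) (σp z) (σm z)) (hσ z) (hcomb z _ _))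
  · refine ⟨fun h => hunique z (by rw [funext h]; exact hcomb z x y) (hτ z), ?_⟩
    rintro ⟨rfl, rfl⟩
    exact congrFun (heq z _ _ _ _ (JacobiLC.isSolution_polyQ ha z)
      ((hsol z _ _).linear_combination (hsol z _ _) (τp z) (τm z)) (hτ z) (hcomb z _ _))
  -- The coefficients are fixed once, using `z = 0`; for every other `z` the formula follows from
  -- their uniqueness.
  · obtain ⟨sp, sm, hs⟩ := JacobiLC.exists_hasAsymptotics ha hsum hβ hβinf hk hβ'
      (JacobiLC.summable_jacobiSub_div_sqrt ha hsum (JacobiLC.memℓp_jacobiSub hu 0))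
    refine ⟨sp, sm, hs, fun z => ?_⟩
    have hh := JacobiLC.memℓp_two_iff.1 (JacobiLC.memℓp_jacobiSub hu z)
    have hqh := (JacobiLC.summable_norm_mul_of_summable_sq
      (JacobiLC.memℓp_two_iff.1 ((hτ z).memℓp ha hsum)) hh).of_norm
    have hph := (JacobiLC.summable_norm_mul_of_summable_sq
      (JacobiLC.memℓp_two_iff.1 ((hσ z).memℓp ha hsum)) hh).of_norm
    obtain ⟨Γ, hΓ⟩ := JacobiLC.exists_forall_eq_polyP_add_quasiResolvent_iff ha hqh
    refine ⟨Γ, hΓ, ?_⟩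
    have hinner : JacobiLC.l2Inner (JacobiLC.jacobiSub a b z u)
        (JacobiLC.polyP a b ((starRingEnd ℂ) z))
        = ∑' n, JacobiLC.polyP a b z n * JacobiLC.jacobiSub a b z u n :=
      tsum_congr fun n => by rw [JacobiLC.conj_polyP_conj, mul_comm]
    have hu' := (hσ z).linear_combination ha
      (JacobiLC.hasAsymptotics_quasiResolvent ha (hσ z) (hτ z) hph) Γ 1
    simp only [one_mul] at hu'
    rw [← funext ((hΓ Γ).2 rfl)] at hu'
    rw [hinner]
    exact hunique z hs hu'
  -- At `z = 0` a solution has `𝓙 u` supported at index 0, so `𝓙 u ∈ ℓ²` is automatic.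
  · have hA := hcomb 0 sp sm
    refine ⟨_, ⟨hA.memℓp ha hsum, ?_⟩, hA⟩
    have hS : JacobiLC.IsSolution a b 0 fun n => sp * fp 0 n + sm * fm 0 n :=
      (hsol 0 _ _).linear_combination (hsol 0 _ _) sp sm
    have hS' := JacobiLC.isSolution_iff.1 hS
    rw [JacobiLC.memℓp_two_iff]
    refine (summable_nat_add_iff 1).1 (summable_zero.congr fun n => ?_)
    have hn := hS' n
    rw [JacobiLC.jacobiSub, zero_mul, sub_zero] at hn
    rw [hn]
    simp
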